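/- Let $G$ be a non-discrete, locally compact (Hausdorff) group with left Haar measure $m$, and let $\omega$ be a weight on $G$, that is, a Borel function $\omega : G \to [1,\infty)$ which is bounded on compact sets and satisfies $\omega(e)=1$ and $\omega(uv) \le \omega(u)\,\omega(v)$ for all $u,v \in G$. Let $L^1(G,\omega)$ be the Banach algebra of all (classes of) functions $f \in L^1(G)$ with $\|f\|_\omega := \int_G |f(t)|\,\omega(t)\,dm(t) < \infty$, with the norm $\|\cdot\|_\omega$ and the convolution product $(f*g)(t) = \int_G f(s)\,g(s^{-1}t)\,dm(s)$. A left ideal $I$ of $A = L^1(G,\omega)$ is a complex linear subspace with $A * I \subseteq I$; it is maximal if it is maximal among the proper left ideals of $A$; it is finitely-generated if there are $n \in \mathbb{N}$ and $x_1,\dots,x_n \in A$ such that $$I = \Big\{ \sum_{i=1}^n (c_i x_i + a_i * x_i) : c_1,\dots,c_n \in \mathbb{C},\ a_1,\dots,a_n \in A \Big\}$$ (no closure is taken on the right-hand side). Then $L^1(G,\omega)$ has no finitely-generated, closed, maximal left ideals, and no finitely-generated, closed left ideals of finite codimension. -/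

import Mathlib

open MeasureTheory

/-- A weight on a locally compact group: a Borel function `ω : G → [1, ∞)` that is submultiplicative,
takes the value `1` at the identity, and is bounded on compact sets. -/
structure IsWeight {G : Type*} [Group G] [TopologicalSpace G] [MeasurableSpace G]
    (ω : G → ℝ) : Prop where
  one_le : ∀ u, 1 ≤ ω u
  map_mul_le : ∀ u v, ω (u * v) ≤ ω u * ω v
  map_one : ω 1 = 1
  measurable : Measurable ω
  bddAbove_image : ∀ K : Set G, IsCompact K → BddAbove (ω '' K)

/-- The measure `ω dm`. For a weight `ω` it has the same null sets as `m`. -/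
noncomputable abbrev weightedMeasure {G : Type*} [MeasurableSpace G] (m : Measure G) (ω : G → ℝ) :
    Measure G :=
  m.withDensity fun t => ENNReal.ofReal (ω t)

/-- The space `L¹(G, ω)` with the norm `‖f‖_ω = ∫ |f(t)| ω(t) dm(t)`, realised as `L¹(ω dm)`; see
`memLp_weightedMeasure_iff` and `norm_weightedL1` below. As usual, functions that agree almost
everywhere are identified. -/
abbrev WeightedL1 {G : Type*} [MeasurableSpace G] (m : Measure G) (ω : G → ℝ) : Type _ :=
  Lp ℂ 1 (weightedMeasure m ω)

theorem ae_weightedMeasure {G : Type*} [Group G] [TopologicalSpace G] [MeasurableSpace G]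
    (m : Measure G) {ω : G → ℝ} (hω : IsWeight ω) :
    ae (weightedMeasure m ω) = ae m := by
  have hpos : ∀ t, ENNReal.ofReal (ω t) ≠ 0 := fun t => by
    have := hω.one_le t
    simp only [ne_eq, ENNReal.ofReal_eq_zero, not_le]
    linarith
  refine le_antisymm (withDensity_absolutelyContinuous m _).ae_le ?_
  exact (withDensity_absolutelyContinuous' hω.measurable.ennreal_ofReal.aemeasurable
    (Filter.Eventually.of_forall hpos)).ae_le

/-- The norm of `L¹(G, ω)` is `‖f‖_ω`. -/
theorem norm_weightedL1 {G : Type*} [Group G] [TopologicalSpace G] [MeasurableSpace G]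
    (m : Measure G) {ω : G → ℝ} (hω : IsWeight ω) (f : WeightedL1 m ω) :
    ‖f‖ = ∫ t, ‖f t‖ * ω t ∂m := by
  rw [L1.norm_eq_integral_norm]
  refine (integral_withDensity_eq_integral_toReal_smul hω.measurable.ennreal_ofReal
    (Filter.Eventually.of_forall fun _ => ENNReal.ofReal_lt_top) _).trans ?_
  refine integral_congr_ae (Filter.Eventually.of_forall fun t => ?_)
  have h0 : 0 ≤ ω t := zero_le_one.trans (hω.one_le t)
  simp [ENNReal.toReal_ofReal h0, mul_comm]

/-- A function represents an element of `L¹(G, ω)` exactly if it is in `L¹(G)` and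
`∫ |f(t)| ω(t) dm(t) < ∞`. -/
theorem memLp_weightedMeasure_iff {G : Type*} [Group G] [TopologicalSpace G] [MeasurableSpace G]
    (m : Measure G) {ω : G → ℝ} (hω : IsWeight ω) (f : G → ℂ) :
    MemLp f 1 (weightedMeasure m ω) ↔
      Integrable f m ∧ Integrable (fun t => ‖f t‖ * ω t) m := by
  have hle : m ≤ weightedMeasure m ω := by
    conv_lhs => rw [← withDensity_one (μ := m)]
    refine withDensity_mono (Filter.Eventually.of_forall fun t => ?_)
    simpa using ENNReal.ofReal_le_ofReal (hω.one_le t)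
  have hac : weightedMeasure m ω ≪ m := withDensity_absolutelyContinuous m _
  have key : Integrable (fun t => ‖f t‖) (weightedMeasure m ω) ↔
      Integrable (fun t => ‖f t‖ * ω t) m := by
    rw [weightedMeasure, integrable_withDensity_iff hω.measurable.ennreal_ofReal
      (Filter.Eventually.of_forall fun _ => ENNReal.ofReal_lt_top)]
    refine integrable_congr (Filter.Eventually.of_forall fun t => ?_)
    have h0 : 0 ≤ ω t := zero_le_one.trans (hω.one_le t)
    simp [ENNReal.toReal_ofReal h0]
  rw [memLp_one_iff_integrable]
  constructor
  · exact fun h => ⟨h.mono_measure hle, key.1 h.norm⟩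
  · exact fun h => (integrable_norm_iff (h.1.aestronglyMeasurable.mono_ac hac)).1 (key.2 h.2)

/-- Convolution of functions on a group: `(f * g)(t) = ∫ f(s) g(s⁻¹ t) dm(s)`. -/
noncomputable def groupConv {G : Type*} [Group G] [MeasurableSpace G] (m : Measure G)
    (f g : G → ℂ) (t : G) : ℂ :=
  ∫ s, f s * g (s⁻¹ * t) ∂m

namespace WeightedL1

variable {G : Type*} [Group G] [MeasurableSpace G] {m : Measure G} {ω : G → ℝ}

open Classical in
/-- The multiplication of `L¹(G, ω)`: the class of the convolution `f * g`. For a left Haar measure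
`m` and a weight `ω`, the integral defining `f * g` converges almost everywhere and
`‖f * g‖_ω ≤ ‖f‖_ω ‖g‖_ω`, so that the alternative `0` never occurs. -/
noncomputable def conv (f g : WeightedL1 m ω) : WeightedL1 m ω :=
  if h : MemLp (groupConv m f g) 1 (weightedMeasure m ω) then h.toLp (groupConv m f g) else 0

/-- A left ideal of `L¹(G, ω)`: a complex subspace `I` with `L¹(G, ω) * I ⊆ I`. -/
def IsLeftIdeal (I : Submodule ℂ (WeightedL1 m ω)) : Prop :=
  ∀ a : WeightedL1 m ω, ∀ x ∈ I, conv a x ∈ I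

/-- A maximal left ideal: maximal among all proper left ideals, closed or not. -/
def IsMaximalLeftIdeal (I : Submodule ℂ (WeightedL1 m ω)) : Prop :=
  Maximal (fun J : Submodule ℂ (WeightedL1 m ω) => IsLeftIdeal J ∧ J ≠ ⊤) I

/-- `I` is (algebraically) finitely generated: `I = A♯ x₁ + ⋯ + A♯ xₙ` for some `x₁, …, xₙ` in
`A = L¹(G, ω)`, where `A♯` is the unitisation of `A`. Here `A♯ x = {c x + a * x : c ∈ ℂ, a ∈ A}`;
no closure is taken. -/
def IsFinitelyGenerated (I : Submodule ℂ (WeightedL1 m ω)) : Prop :=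
  ∃ (n : ℕ) (x : Fin n → WeightedL1 m ω), ∀ y : WeightedL1 m ω,
    y ∈ I ↔ ∃ (c : Fin n → ℂ) (a : Fin n → WeightedL1 m ω),
      y = ∑ i, (c i • x i + conv (a i) (x i))

end WeightedL1

/-! Let `A` be the algebra and `J` its subspace of essentially bounded functions, the image of the
Banach space `L¹ ∩ L^∞`. `J` is a dense left ideal, and `J ≠ A` because a non-discrete `G` has sets
of arbitrarily small positive measure. A closed left ideal `I` that is maximal or of finite
codimension satisfies `I + J = A`.

Suppose such an `I` is finitely generated. Since `I + J = A`, the open mapping theorem makes `I ∩ J`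
dense in `I` (`Submodule.le_topologicalClosure_inf_range`). Generation means that a bounded operator
from `ℂⁿ × Aⁿ` onto the Banach space `I` is surjective, and surjectivity survives small
perturbations, so the generators may be moved into `I ∩ J`. As `J` is a left ideal, `I ⊆ J`
(`le_range_of_finitelyGenerated`), hence `J = A`, a contradiction.

Much of the rest shows that convolution is a bounded bilinear map when `G` need not be σ-compact:
Tonelli's theorem is replaced by approximation from `C_c`. -/

open Filter Topology
open scoped ENNReal NNReal Pointwise

/-! ### Consequences of the open mapping theorem. -/

section BanachSpace

variable {E F : Type*} [NormedAddCommGroup E] [NormedSpace ℂ E] [CompleteSpace E]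
  [NormedAddCommGroup F] [NormedSpace ℂ F] [CompleteSpace F]

/-- Surjectivity of a bounded operator between Banach spaces is stable under small perturbations. -/
theorem ContinuousLinearMap.exists_pos_forall_surjective_of_norm_sub_lt (T : E →L[ℂ] F)
    (hT : Function.Surjective T) :
    ∃ δ > 0, ∀ S : E →L[ℂ] F, ‖S - T‖ < δ → Function.Surjective S := by
  set R := T.nonlinearRightInverseOfSurjective (LinearMap.range_eq_top.2 hT) with hR
  have hpos : 0 < R.nnnorm := T.nonlinearRightInverseOfSurjective_nnnorm_pos _
  have hpos' : (0 : ℝ) < (R.nnnorm : ℝ)⁻¹ := by positivity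
  refine ⟨(R.nnnorm : ℝ)⁻¹, hpos', fun S hS y => ?_⟩
  have happ : ApproximatesLinearOn S T Set.univ ‖S - T‖₊ := by
    intro u _ v _
    have := (S - T).le_opNorm (u - v)
    simpa [sub_apply, map_sub, sub_sub_sub_comm] using this
  set d := (R.nnnorm : ℝ)⁻¹ - ‖S - T‖ with hd
  have hd0 : 0 < d := sub_pos.2 hS
  -- The image of the ball of radius `r` about `0` contains the ball of radius `d * r`; `r = ‖y‖ /
  -- d` just reaches `y`.
  have key := happ.surjOn_closedBall_of_nonlinearRightInverse R (ε := ‖y‖ / d) (b := 0)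
    (by positivity) (Set.subset_univ _)
  obtain ⟨x, -, hx⟩ := key (show y ∈ _ by
    rw [mem_closedBall_iff_norm, coe_nnnorm, ← hd, map_zero, sub_zero, mul_div_cancel₀ _ hd0.ne'])
  exact ⟨x, hx⟩

/-- If a Banach space `E` maps continuously onto a dense subspace of `F` that complements the
closed subspace `I`, then the intersection of `I` with the image of `E` is dense in `I`. -/
theorem Submodule.le_topologicalClosure_inf_range (j : E →L[ℂ] F) (hj : DenseRange j)
    (I : Submodule ℂ F) (hI : IsClosed (I : Set F)) (hIj : I ⊔ j.range = ⊤) :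
    I ≤ (I ⊓ j.range).topologicalClosure := by
  have := hI
  let q : F →L[ℂ] F ⧸ I := I.mkQL
  have hq : Function.Surjective (q.comp j) := by
    intro y
    obtain ⟨z, rfl⟩ := I.mkQ_surjective y
    obtain ⟨u, hu, _, ⟨e, rfl⟩, rfl⟩ := Submodule.mem_sup.1 (hIj ▸ Submodule.mem_top : z ∈ I ⊔ j.range)
    refine ⟨e, ?_⟩
    change I.mkQ (j e) = I.mkQ (u + j e)
    rw [map_add, (by simpa using hu : I.mkQ u = 0), zero_add]
  obtain ⟨C, hC, hinv⟩ := (q.comp j).exists_preimage_norm_le hq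
  intro x hx
  rw [← SetLike.mem_coe, Submodule.topologicalClosure_coe, Metric.mem_closure_iff]
  intro ε hε
  -- If `j e` is close to `x ∈ I`, its class modulo `I` is small, so it has a small lift `e'`; then
  -- `j (e - e')` lies in `I` and is still close to `x`. `M` is the loss in this correction.
  set M := 1 + ‖j‖ * C with hM
  have hM0 : 0 < M := by positivity
  obtain ⟨e, he⟩ := hj.exists_dist_lt x (div_pos hε hM0)
  obtain ⟨e', he', hn⟩ := hinv (q (j e))
  have hnorm : ‖q (j e)‖ ≤ ‖j e - x‖ := by
    have : q (j e) = q (j e - x) := by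
      change I.mkQ (j e) = I.mkQ (j e - x)
      rw [map_sub, (by simpa using hx : I.mkQ x = 0), sub_zero]
    rw [this]
    exact Submodule.Quotient.norm_mk_le I _
  refine ⟨j (e - e'), ⟨?_, ⟨_, rfl⟩⟩, ?_⟩
  · have : I.mkQ (j (e - e')) = 0 := by
      change q (j (e - e')) = 0
      rw [map_sub, map_sub, sub_eq_zero]
      exact he'.symm
    exact (Submodule.Quotient.mk_eq_zero I).1 this
  · rw [dist_eq_norm] at he ⊢
    rw [norm_sub_rev] at hnorm
    have h1 : x - j (e - e') = (x - j e) + j e' := by rw [map_sub]; abel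
    calc ‖x - j (e - e')‖ ≤ ‖x - j e‖ + ‖j e'‖ := h1 ▸ norm_add_le _ _
      _ ≤ ‖x - j e‖ + ‖j‖ * (C * ‖x - j e‖) := by
        gcongr
        exact (j.le_opNorm _).trans (by gcongr; exact hn.trans (by gcongr))
      _ = M * ‖x - j e‖ := by rw [hM]; ring
      _ < M * (ε / M) := by gcongr
      _ = ε := mul_div_cancel₀ _ hM0.ne'

end BanachSpace

/-! ### Perturbing the generators of a left ideal. -/

section BilinearProduct

variable {A : Type*} [NormedAddCommGroup A] [NormedSpace ℂ A]

/-- The operator `(c, a) ↦ ∑ i, (c i • x i + B (a i) (x i))`, as a continuous linear function of the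
generators `x`. -/
noncomputable def generatedBy (B : A →L[ℂ] A →L[ℂ] A) (n : ℕ) :
    (Fin n → A) →L[ℂ] ((Fin n → ℂ) × (Fin n → A)) →L[ℂ] A :=
  ∑ i, (((ContinuousLinearMap.lsmul ℂ ℂ (E := A)).bilinearComp
      ((ContinuousLinearMap.proj i).comp (ContinuousLinearMap.fst ℂ (Fin n → ℂ) (Fin n → A)))
      (ContinuousLinearMap.proj (R := ℂ) (φ := fun _ : Fin n => A) i)).flip +
    (B.bilinearComp
      ((ContinuousLinearMap.proj i).comp (ContinuousLinearMap.snd ℂ (Fin n → ℂ) (Fin n → A)))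
      (ContinuousLinearMap.proj (R := ℂ) (φ := fun _ : Fin n => A) i)).flip)

theorem generatedBy_apply (B : A →L[ℂ] A →L[ℂ] A) {n : ℕ} (x : Fin n → A)
    (p : (Fin n → ℂ) × (Fin n → A)) :
    generatedBy B n x p = ∑ i, (p.1 i • x i + B (p.2 i) (x i)) := by
  simp [generatedBy]

/-- A closed, finitely generated left ideal is contained in every dense left ideal that is the image
of a Banach space and that complements it. -/
theorem le_range_of_finitelyGenerated [CompleteSpace A] {E : Type*} [NormedAddCommGroup E]
    [NormedSpace ℂ E] [CompleteSpace E] (B : A →L[ℂ] A →L[ℂ] A)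
    (I : Submodule ℂ A) (hIc : IsClosed (I : Set A)) (hI : ∀ a, ∀ x ∈ I, B a x ∈ I)
    {n : ℕ} (x : Fin n → A) (hx : ∀ y, y ∈ I ↔ ∃ (c : Fin n → ℂ) (a : Fin n → A),
      y = ∑ i, (c i • x i + B (a i) (x i)))
    (j : E →L[ℂ] A) (hj : DenseRange j) (hJ : ∀ a, ∀ x ∈ j.range, B a x ∈ j.range)
    (hIj : I ⊔ j.range = ⊤) : I ≤ j.range := by
  have : CompleteSpace I := hIc.completeSpace_coe
  have hmem : ∀ y : Fin n → I, ∀ p, generatedBy B n (fun i => (y i : A)) p ∈ I := by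
    intro y p
    rw [generatedBy_apply]
    exact I.sum_mem fun i _ => I.add_mem (I.smul_mem _ (y i).2) (hI _ _ (y i).2)
  -- The codomain has to be `I`, complete because closed: the perturbation argument needs
  -- surjectivity onto a Banach space.
  let T : (Fin n → I) → ((Fin n → ℂ) × (Fin n → A)) →L[ℂ] I := fun y =>
    (generatedBy B n (fun i => (y i : A))).codRestrict I (hmem y)
  have hxI : ∀ i, x i ∈ I := fun i => (hx _).2 ⟨Pi.single i 1, 0, by
    simp [Pi.single_apply]⟩
  let x' : Fin n → I := fun i => ⟨x i, hxI i⟩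
  have hT : Function.Surjective (T x') := by
    intro y
    obtain ⟨c, a, hy⟩ := (hx y).1 y.2
    exact ⟨(c, a), Subtype.ext ((generatedBy_apply B x (c, a)).trans hy.symm)⟩
  obtain ⟨δ, hδ, hsurj⟩ := (T x').exists_pos_forall_surjective_of_norm_sub_lt hT
  set M := ‖generatedBy B n‖ + 1 with hM
  have hM0 : 0 < M := by positivity
  have hdense : ∀ i, ∃ y ∈ I ⊓ j.range, dist (x i) y < δ / M := fun i => by
    have := Submodule.le_topologicalClosure_inf_range j hj I hIc hIj (hxI i)
    rw [← SetLike.mem_coe, Submodule.topologicalClosure_coe, Metric.mem_closure_iff] at this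
    exact this _ (div_pos hδ hM0)
  choose y hyIJ hxy using hdense
  let y' : Fin n → I := fun i => ⟨y i, (hyIJ i).1⟩
  have hyx : ‖y - x‖ < δ / M := by
    refine (pi_norm_lt_iff (div_pos hδ hM0)).2 fun i => ?_
    rw [Pi.sub_apply, ← dist_eq_norm, dist_comm]
    exact hxy i
  have hclose : ‖T y' - T x'‖ < δ := by
    refine lt_of_le_of_lt (ContinuousLinearMap.opNorm_le_bound _ (M := M * ‖y - x‖)
      (by positivity) fun p => ?_) ?_
    · change ‖generatedBy B n y p - generatedBy B n x p‖ ≤ _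
      have h1 : generatedBy B n y p - generatedBy B n x p = generatedBy B n (y - x) p := by
        simp
      rw [h1]
      refine ((generatedBy B n).le_opNorm₂ _ _).trans ?_
      gcongr
      linarith
    · calc M * ‖y - x‖ < M * (δ / M) := by gcongr
        _ = δ := mul_div_cancel₀ _ hM0.ne'
  intro z hz
  obtain ⟨p, hp⟩ := hsurj _ hclose ⟨z, hz⟩
  have hz' : z = ∑ i, (p.1 i • y i + B (p.2 i) (y i)) := by
    rw [← generatedBy_apply]
    exact (congrArg Subtype.val hp).symm
  rw [hz']
  exact Submodule.sum_mem _ fun i _ =>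
    Submodule.add_mem _ (Submodule.smul_mem _ _ (hyIJ i).2) (hJ _ _ (hyIJ i).2)

end BilinearProduct

/-! ### Inversion and Haar null sets. -/

section HaarMeasure

variable {G : Type*} [Group G] [TopologicalSpace G] [IsTopologicalGroup G]
    [LocallyCompactSpace G] [MeasurableSpace G] [BorelSpace G]

/-- Inversion preserves the null sets of a regular Haar measure, also when `G` is not second
countable. -/
theorem measure_inv_eq_zero_of_regular (m : Measure G) [m.IsHaarMeasure] [m.Regular] {N : Set G}
    (hN : m N = 0) : m.inv N = 0 := by
  obtain ⟨⟨g, hg⟩, h'g, g_nonneg, g_pos⟩ :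
    ∃ g : C(G, ℝ), HasCompactSupport g ∧ 0 ≤ g ∧ g 1 ≠ 0 := exists_continuous_nonneg_pos 1
  have hg : Continuous g := hg
  set D : G → ℝ := fun x => ∫ y, g (y⁻¹ * x) ∂m.inv with hD
  have D_cont : Continuous D := continuous_integral_apply_inv_mul hg h'g
  have D_pos : ∀ x, 0 < D x := by
    intro x
    have C : Continuous (fun y ↦ g (y⁻¹ * x)) := by fun_prop
    refine (integral_pos_iff_support_of_nonneg (fun y ↦ g_nonneg (y⁻¹ * x)) ?_).2 ?_
    · apply C.integrable_of_hasCompactSupport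
      exact h'g.comp_homeomorph ((Homeomorph.inv G).trans (Homeomorph.mulRight x))
    · exact C.isOpen_support.measure_pos m.inv ⟨x * 1⁻¹, by simpa using g_pos⟩
  set c := ∫ x, g x ∂m with hc
  have c_pos : 0 < c := hg.integral_pos_of_hasCompactSupport_nonneg_nonzero h'g g_nonneg g_pos
  -- On `C_c`, the right-invariant measure `m.inv` has the continuous positive density `D / c` with
  -- respect to `m`.
  have key : ∀ f : G → ℝ, Continuous f → HasCompactSupport f →
      ∫ x, f x * D x ∂m = (∫ x, f x ∂m.inv) * c := by
    intro f hf h'f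
    refine (Measure.integral_isMulLeftInvariant_isMulRightInvariant_combo (ν := m.inv)
      (hf.mul D_cont) h'f.mul_right hg h'g g_nonneg g_pos).trans ?_
    congr 2 with x
    exact mul_inv_cancel_right₀ (D_pos x).ne' _
  have bound : ∀ (U : Set G) (M : ℝ), 0 ≤ M → IsOpen U → (∀ x ∈ U, D x ≤ M) →
      m.inv U ≤ ENNReal.ofReal (M / c) * m U := by
    intro U M hM hU hUM
    rcases eq_or_ne (m U) ∞ with htop | htop
    · rcases hM.eq_or_lt with rfl | hM
      · have : U = ∅ := Set.eq_empty_of_forall_notMem fun x hx => (D_pos x).not_ge (hUM x hx)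
        simp [this]
      · rw [htop, ENNReal.mul_top]
        · exact le_top
        · simpa using div_pos hM c_pos
    rw [hU.measure_eq_iSup_isCompact]
    -- By inner regularity of `m.inv` on open sets, a Urysohn function between `K` and `U` transfers
    -- the bound from `C_c` to `U`.
    refine iSup_le fun K => iSup_le fun hKU => iSup_le fun hK => ?_
    obtain ⟨f, hf1, hf0, h'f, hf01⟩ := exists_continuous_one_zero_of_isCompact hK
      hU.isClosed_compl (Set.disjoint_compl_right_iff_subset.2 hKU)
    have hKf : m.inv K ≤ ENNReal.ofReal (∫ x, f x ∂m.inv) := by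
      rw [ofReal_integral_eq_lintegral_ofReal (f.continuous.integrable_of_hasCompactSupport h'f)
        (Eventually.of_forall fun x => (hf01 x).1)]
      calc m.inv K ≤ m.inv {x | 1 ≤ ENNReal.ofReal (f x)} :=
            measure_mono fun x hx => by simp [hf1 hx]
        _ ≤ _ := by
          simpa using meas_ge_le_lintegral_div
            (f.continuous.measurable.ennreal_ofReal.aemeasurable (μ := m.inv))
            one_ne_zero ENNReal.one_ne_top
    have hfm : ∫ x, f x * D x ∂m ≤ M * (m U).toReal := by
      calc ∫ x, f x * D x ∂m ≤ ∫ x, U.indicator (fun _ => M) x ∂m := by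
            refine integral_mono ?_ ?_ fun x => ?_
            · exact (f.continuous.mul D_cont).integrable_of_hasCompactSupport h'f.mul_right
            · exact (integrable_indicator_iff hU.measurableSet).2 (integrableOn_const htop)
            · by_cases hx : x ∈ U
              · simp only [hx, Set.indicator_of_mem]
                nlinarith [hf01 x |>.1, hf01 x |>.2, hUM x hx, D_pos x]
              · simp [hx, hf0 (Set.mem_compl hx)]
        _ = M * (m U).toReal := by
          rw [integral_indicator hU.measurableSet, setIntegral_const, smul_eq_mul, mul_comm]
          rfl
    rw [key f f.continuous h'f] at hfm
    calc m.inv K ≤ ENNReal.ofReal (∫ x, f x ∂m.inv) := hKf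
      _ ≤ ENNReal.ofReal (M / c * (m U).toReal) := by
        refine ENNReal.ofReal_le_ofReal ?_
        rw [div_mul_eq_mul_div, le_div_iff₀ c_pos]
        exact hfm
      _ = ENNReal.ofReal (M / c) * m U := by
        rw [ENNReal.ofReal_mul (by positivity), ENNReal.ofReal_toReal htop]
  -- `D` may be unbounded, so the estimate is applied on each open set where it is below `n`.
  have hcover : N ⊆ ⋃ n : ℕ, N ∩ {x | D x < n} := fun x hx => by
    obtain ⟨n, hn⟩ := exists_nat_gt (D x)
    exact Set.mem_iUnion.2 ⟨n, hx, hn⟩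
  refine measure_mono_null hcover (measure_iUnion_null fun n => ?_)
  have hM : (0 : ℝ) ≤ n := n.cast_nonneg
  refine nonpos_iff_eq_zero.1 (ENNReal.le_of_forall_pos_le_add fun ε hε _ => ?_)
  rw [zero_add]
  -- The `+ 1` keeps the denominator nonzero when `n = 0`.
  obtain ⟨U, hNU, hU, hUε⟩ := Set.exists_isOpen_lt_of_lt N
    ((ε : ℝ≥0∞) / (ENNReal.ofReal (n / c) + 1)) (by
      rw [hN]
      exact ENNReal.div_pos (by exact_mod_cast hε.ne') (by finiteness))
  calc m.inv (N ∩ {x | D x < n}) ≤ m.inv (U ∩ {x | D x < n}) :=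
        measure_mono (Set.inter_subset_inter_left _ hNU)
    _ ≤ ENNReal.ofReal (n / c) * m (U ∩ {x | D x < n}) :=
        bound _ n hM (hU.inter (isOpen_lt D_cont continuous_const)) fun x hx => hx.2.le
    _ ≤ (ENNReal.ofReal (n / c) + 1) * (ε / (ENNReal.ofReal (n / c) + 1)) := by
        gcongr
        · exact le_self_add
        · exact (measure_mono Set.inter_subset_left).trans hUε.le
    _ ≤ ε := ENNReal.mul_div_le

/-- The map `s ↦ s⁻¹ * t` is left translation by `t⁻¹` followed by inversion. Hence changing `g` on
a null set does not affect the integral defining `f * g` at any point. -/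
theorem ae_inv_mul_of_ae (m : Measure G) [m.IsHaarMeasure] [m.Regular] {p : G → Prop}
    (hp : ∀ᵐ x ∂m, p x) (t : G) : ∀ᵐ s ∂m, p (s⁻¹ * t) := by
  have h1 : ∀ᵐ x ∂m, p x⁻¹ := by
    have h0 : ∀ᵐ x ∂m.inv, p x := measure_inv_eq_zero_of_regular m hp
    exact ae_of_ae_map measurable_inv.aemeasurable h0
  have h2 := (measurePreserving_mul_left m t⁻¹).quasiMeasurePreserving.ae h1
  filter_upwards [h2] with s hs
  simpa using hs

end HaarMeasure

/-! ### Approximation of integrable functions from `C_c`. -/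

section Approximation

variable {X : Type*} [TopologicalSpace X] [MeasurableSpace X] [BorelSpace X] [R1Space X]
  [LocallyCompactSpace X]

/-- Density of `C_c` in `L¹`, without assuming that the locally compact space `X` is normal. -/
theorem MeasureTheory.Integrable.exists_hasCompactSupport_lintegral_sub_le' {m : Measure X}
    [m.Regular] {f : X → ℂ} (hf : Integrable f m) {ε : ℝ≥0∞} (hε : ε ≠ 0) :
    ∃ g : X → ℂ, HasCompactSupport g ∧ (∫⁻ x, ‖f x - g x‖ₑ ∂m) ≤ ε ∧ Continuous g ∧
      Integrable g m := by
  suffices H : ∃ g : X → ℂ, eLpNorm (f - g) 1 m ≤ ε ∧ (Continuous g ∧ HasCompactSupport g) by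
    obtain ⟨g, hg, hgc, hgs⟩ := H
    rw [eLpNorm_one_eq_lintegral_enorm] at hg
    exact ⟨g, hgs, hg, hgc, hgc.integrable_of_hasCompactSupport hgs⟩
  refine (memLp_one_iff_integrable.2 hf).induction_dense ENNReal.one_ne_top _ ?_ ?_ ?_ hε
  · intro c t ht htm ε hε
    -- The Urysohn approximant differs from the indicator of `t` only on `U \ K`, by at most `‖c‖`,
    -- so it suffices that this set has measure at most `η`.
    obtain ⟨η, ηpos, hη⟩ := exists_eLpNorm_indicator_le (μ := m) ENNReal.one_ne_top c hε
    have hη2 : (η / 2 : ℝ≥0∞) ≠ 0 := by simpa using ηpos.ne'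
    obtain ⟨K, hKt, hK, hKc, hKη⟩ := ht.exists_isCompact_isClosed_sdiff_lt htm.ne hη2
    obtain ⟨U, htU, hU, -, hUη⟩ := ht.exists_isOpen_sdiff_lt htm.ne hη2
    obtain ⟨g, hg1, hg0, h'g, hg01⟩ := exists_continuous_one_zero_of_isCompact hK
      hU.isClosed_compl (Set.disjoint_compl_right_iff_subset.2 (hKt.trans htU))
    refine ⟨fun x => g x • c, ?_, by fun_prop, h'g.smul_right⟩
    refine le_trans (eLpNorm_mono fun x => ?_) (hη (U \ K) ?_)
    · by_cases hxK : x ∈ K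
      · simp [hxK, hKt hxK, hg1 hxK]
      by_cases hxU : x ∈ U
      · rw [Set.indicator_of_mem (show x ∈ U \ K from ⟨hxU, hxK⟩), Pi.sub_apply]
        have h01 := hg01 x
        have hnorm : ‖g x • c‖ ≤ ‖c‖ ∧ ‖g x • c - c‖ ≤ ‖c‖ := by
          have h1 : g x • c - c = (g x - 1) • c := by rw [sub_smul, one_smul]
          rw [h1, norm_smul, norm_smul]
          constructor <;> refine mul_le_of_le_one_left (norm_nonneg _) ?_ <;>
            rw [Real.norm_eq_abs, abs_le] <;> constructor <;> linarith [h01.1, h01.2]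
        by_cases hxt : x ∈ t
        · rw [Set.indicator_of_mem hxt]
          exact hnorm.2
        · rw [Set.indicator_of_notMem hxt, sub_zero]
          exact hnorm.1
      · simp [hxU, hg0 (show x ∈ Uᶜ from hxU), show x ∉ t from fun h => hxU (htU h)]
    · calc m (U \ K) ≤ m (U \ t ∪ t \ K) := measure_mono fun x hx => by
            by_cases hxt : x ∈ t
            · exact Or.inr ⟨hxt, hx.2⟩
            · exact Or.inl ⟨hx.1, hxt⟩
        _ ≤ m (U \ t) + m (t \ K) := measure_union_le _ _
        _ ≤ η / 2 + η / 2 := add_le_add hUη.le hKη.le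
        _ = η := ENNReal.add_halves _
  · rintro f g ⟨hf, hf'⟩ ⟨hg, hg'⟩
    exact ⟨hf.add hg, hf'.add hg'⟩
  · rintro f ⟨hf, -⟩
    exact hf.aestronglyMeasurable

/-- An integrable function is almost everywhere the limit of a sequence `F` in `C_c` that is
dominated by a series in `C_c` whose norm is as close to that of `f` as we like. -/
theorem MeasureTheory.Integrable.exists_tendsto_hasCompactSupport {m : Measure X} [m.Regular]
    {f : X → ℂ} (hf : Integrable f m) {ε : ℝ≥0} (hε : 0 < ε) :
    ∃ F h : ℕ → X → ℂ, (∀ n, Continuous (F n) ∧ HasCompactSupport (F n)) ∧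
      (∀ n, Continuous (h n) ∧ HasCompactSupport (h n)) ∧
      (∀ᵐ x ∂m, Tendsto (fun n => F n x) atTop (𝓝 (f x))) ∧
      (∀ n x, ‖F n x‖ₑ ≤ ∑' k, ‖h k x‖ₑ) ∧
      ∑' k, ∫⁻ x, ‖h k x‖ₑ ∂m ≤ ∫⁻ x, ‖f x‖ₑ ∂m + ε := by
  -- Each error `δ k` enters the final bound twice, through `F k - F (k - 1)` and `F (k + 1) - F k`,
  -- with `f` in place of `F (-1)`; hence the total `ε / 2`.
  obtain ⟨δ, hδ, hδsum⟩ := ENNReal.exists_pos_sum_of_countable'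
    (ENNReal.coe_ne_zero.2 (half_pos hε).ne') ℕ
  have happ : ∀ n, ∃ g : X → ℂ, HasCompactSupport g ∧ (∫⁻ x, ‖f x - g x‖ₑ ∂m) ≤ δ n ∧
      Continuous g ∧ Integrable g m := fun n =>
     hf.exists_hasCompactSupport_lintegral_sub_le' (hδ n).ne'
  choose F hFc hFd hF hFi using happ
  have hmeas : ∀ n, AEMeasurable (fun x => ‖f x - F n x‖ₑ) m := fun n =>
    (hf.sub (hFi n)).1.enorm
  -- Telescoping differences: `F n` is the sum of `h 0, …, h n`.
  let h : ℕ → X → ℂ := fun n => Nat.casesOn n (F 0) fun k x => F (k + 1) x - F k x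
  refine ⟨F, h, fun n => ⟨hF n, hFc n⟩, ?_, ?_, ?_, ?_⟩
  · rintro (_ | k)
    · exact ⟨hF 0, hFc 0⟩
    · exact ⟨(hF _).sub (hF _), (hFc _).sub (hFc _)⟩
  · have hfin : ∫⁻ x, ∑' n, ‖f x - F n x‖ₑ ∂m ≠ ∞ := by
      rw [lintegral_tsum hmeas]
      exact ((ENNReal.tsum_le_tsum hFd).trans_lt (hδsum.trans ENNReal.coe_lt_top)).ne
    filter_upwards [ae_lt_top' (AEMeasurable.tsum hmeas) hfin] with x hx
    have h0 := ENNReal.tendsto_atTop_zero_of_tsum_ne_top hx.ne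
    rw [tendsto_iff_edist_tendsto_0]
    refine h0.congr fun n => ?_
    rw [edist_comm, edist_eq_enorm_sub]
  · intro n x
    have hsum : ∀ n, F n x = ∑ k ∈ Finset.range (n + 1), h k x := by
      intro n
      induction n with
      | zero => simp [h]
      | succ n ih => rw [Finset.sum_range_succ, ← ih]; simp [h]
    rw [hsum]
    exact (enorm_sum_le _ _).trans (ENNReal.sum_le_tsum _)
  · have h0 : ∫⁻ x, ‖h 0 x‖ₑ ∂m ≤ ∫⁻ x, ‖f x‖ₑ ∂m + δ 0 := by
      refine le_trans ?_ (add_le_add_right (hFd 0) _)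
      rw [← lintegral_add_left' hf.1.enorm]
      refine lintegral_mono fun x => ?_
      calc ‖F 0 x‖ₑ = ‖f x - (f x - F 0 x)‖ₑ := by rw [sub_sub_cancel]
        _ ≤ _ := enorm_sub_le
    have h1 : ∀ k, ∫⁻ x, ‖h (k + 1) x‖ₑ ∂m ≤ δ k + δ (k + 1) := fun k => by
      refine le_trans ?_ (add_le_add (hFd k) (hFd (k + 1)))
      rw [← lintegral_add_left' (hmeas k)]
      refine lintegral_mono fun x => ?_
      calc ‖F (k + 1) x - F k x‖ₑ = ‖(f x - F k x) - (f x - F (k + 1) x)‖ₑ := by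
            rw [sub_sub_sub_cancel_left]
        _ ≤ _ := enorm_sub_le
    rw [tsum_eq_zero_add' ENNReal.summable]
    calc _ ≤ (∫⁻ x, ‖f x‖ₑ ∂m + δ 0) + ∑' k, (δ k + δ (k + 1)) :=
          add_le_add h0 (ENNReal.tsum_le_tsum h1)
      _ = ∫⁻ x, ‖f x‖ₑ ∂m + (∑' k, δ k + (δ 0 + ∑' k, δ (k + 1))) := by
          rw [ENNReal.tsum_add]; ring
      _ = ∫⁻ x, ‖f x‖ₑ ∂m + (∑' k, δ k + ∑' k, δ k) := by
          rw [← tsum_eq_zero_add' ENNReal.summable]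
      _ ≤ ∫⁻ x, ‖f x‖ₑ ∂m + ((ε / 2 : ℝ≥0) + (ε / 2 : ℝ≥0)) := by gcongr
      _ = _ := by rw [← ENNReal.coe_add, add_halves]

end Approximation

/-! ### Convolution on `L¹(G)` for a regular Haar measure. -/

section Convolution

variable {G : Type*} [Group G] [TopologicalSpace G] [IsTopologicalGroup G]
    [LocallyCompactSpace G] [MeasurableSpace G] [BorelSpace G] {m : Measure G}

omit [LocallyCompactSpace G] in
theorem continuous_integral_mul_inv_mul {𝕜 : Type*} [RCLike 𝕜] [IsFiniteMeasureOnCompacts m]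
    {h k : G → 𝕜} (hh : Continuous h) (h'h : HasCompactSupport h) (hk : Continuous k) :
    Continuous fun t => ∫ s, h s * k (s⁻¹ * t) ∂m := by
  rw [← continuousOn_univ]
  refine continuousOn_integral_of_compact_support h'h (Continuous.continuousOn ?_)
    fun t s _ hs => ?_
  · exact (hh.comp continuous_snd).mul (hk.comp (continuous_snd.inv.mul continuous_fst))
  · rw [image_eq_zero_of_notMem_tsupport hs, zero_mul]

theorem measurable_lintegral_enorm_mul_inv_mul [IsFiniteMeasureOnCompacts m] {h k : G → ℂ}
    (hh : Continuous h) (h'h : HasCompactSupport h) (hk : Continuous k) :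
    Measurable fun t => ∫⁻ s, ‖h s‖ₑ * ‖k (s⁻¹ * t)‖ₑ ∂m := by
  have := (continuous_integral_mul_inv_mul (m := m) hh.norm h'h.norm hk.norm).measurable.ennreal_ofReal
  convert this using 2 with t
  rw [ofReal_integral_eq_lintegral_ofReal]
  · simp [ENNReal.ofReal_mul]
  · exact Continuous.integrable_of_hasCompactSupport (by fun_prop) h'h.norm.mul_right
  · exact Eventually.of_forall fun s => by positivity

/-- For continuous functions with compact support the order of integration can be exchanged without
σ-finiteness; left invariance then evaluates the inner integral. -/
theorem lintegral_lintegral_enorm_mul_inv_mul [m.IsHaarMeasure] {h k : G → ℂ}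
    (hh : Continuous h) (h'h : HasCompactSupport h) (hk : Continuous k)
    (h'k : HasCompactSupport k) :
    ∫⁻ t, ∫⁻ s, ‖h s‖ₑ * ‖k (s⁻¹ * t)‖ₑ ∂m ∂m = (∫⁻ s, ‖h s‖ₑ ∂m) * ∫⁻ s, ‖k s‖ₑ ∂m := by
  have hcont := continuous_integral_mul_inv_mul (m := m) hh.norm h'h.norm hk.norm
  have hin : ∀ t, ∫⁻ s, ‖h s‖ₑ * ‖k (s⁻¹ * t)‖ₑ ∂m =
      ENNReal.ofReal (∫ s, ‖h s‖ * ‖k (s⁻¹ * t)‖ ∂m) := fun t => by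
    rw [ofReal_integral_eq_lintegral_ofReal]
    · simp [ENNReal.ofReal_mul]
    · exact Continuous.integrable_of_hasCompactSupport (by fun_prop) h'h.norm.mul_right
    · exact Eventually.of_forall fun s => by positivity
  have hsupp : ∀ p : G × G, p ∉ (tsupport h * tsupport k) ×ˢ tsupport h →
      ‖h p.2‖ * ‖k (p.2⁻¹ * p.1)‖ = 0 := by
    rintro ⟨t, s⟩ hp
    by_contra hne
    have h1 : s ∈ tsupport h := by
      by_contra hs
      simp [image_eq_zero_of_notMem_tsupport hs] at hne
    have h2 : s⁻¹ * t ∈ tsupport k := by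
      by_contra hs
      simp [image_eq_zero_of_notMem_tsupport hs] at hne
    exact hp ⟨⟨s, h1, _, h2, mul_inv_cancel_left _ _⟩, h1⟩
  have hK : IsCompact (tsupport h * tsupport k) := IsCompact.mul h'h h'k
  have hsupp' : ∀ t, t ∉ tsupport h * tsupport k → ∫ s, ‖h s‖ * ‖k (s⁻¹ * t)‖ ∂m = 0 := by
    intro t ht
    have : ∀ s, ‖h s‖ * ‖k (s⁻¹ * t)‖ = 0 := fun s => hsupp (t, s) fun hp => ht hp.1
    simp [this]
  simp_rw [hin]
  rw [← ofReal_integral_eq_lintegral_ofReal (hcont.integrable_of_hasCompactSupport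
      (HasCompactSupport.intro hK hsupp'))
      (Eventually.of_forall fun t => integral_nonneg fun s => by positivity),
    integral_integral_swap_of_hasCompactSupport
      (f := fun t s => ‖h s‖ * ‖k (s⁻¹ * t)‖) (by fun_prop)
      (HasCompactSupport.intro (hK.prod h'h) hsupp)]
  have : ∀ s, ∫ t, ‖h s‖ * ‖k (s⁻¹ * t)‖ ∂m = ‖h s‖ * ∫ t, ‖k t‖ ∂m := fun s => by
    rw [integral_const_mul, integral_mul_left_eq_self (fun t => ‖k t‖)]
  simp_rw [this]
  rw [integral_mul_const, ENNReal.ofReal_mul (by positivity),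
    ofReal_integral_norm_eq_lintegral_enorm (hh.integrable_of_hasCompactSupport h'h),
    ofReal_integral_norm_eq_lintegral_enorm (hk.integrable_of_hasCompactSupport h'k)]

/-- Tonelli's theorem for convolutions, up to `ε`. -/
theorem groupConv_estimates_of_pos [m.IsHaarMeasure] [m.Regular] {f g : G → ℂ}
    (hf : Integrable f m) (hg : Integrable g m) {ε : ℝ≥0} (hε : 0 < ε) :
    AEStronglyMeasurable (groupConv m f g) m ∧
    (∀ᵐ t ∂m, Integrable (fun s => f s * g (s⁻¹ * t)) m) ∧
    ∫⁻ t, ‖groupConv m f g t‖ₑ ∂m ≤ (∫⁻ s, ‖f s‖ₑ ∂m + ε) * (∫⁻ s, ‖g s‖ₑ ∂m + ε) := by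
  obtain ⟨F, h, hF, hh, hFf, hFh, hhε⟩ := hf.exists_tendsto_hasCompactSupport hε
  obtain ⟨K, k, hK, hk, hKg, hKk, hkε⟩ := hg.exists_tendsto_hasCompactSupport hε
  -- A measurable majorant of `t ↦ ∫⁻ s, ‖f s * g (s⁻¹ * t)‖ₑ ∂m`. Its integral is computed term by
  -- term in `C_c`, so joint measurability of `f s * g (s⁻¹ * t)` is never needed.
  set Φ : G → ℝ≥0∞ := fun t => ∑' i, ∑' j, ∫⁻ s, ‖h i s‖ₑ * ‖k j (s⁻¹ * t)‖ₑ ∂m with hΦ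
  have hΦmeas : Measurable Φ := Measurable.tsum fun i => Measurable.tsum fun j =>
    measurable_lintegral_enorm_mul_inv_mul (hh i).1 (hh i).2 (hk j).1
  have hΦint : ∫⁻ t, Φ t ∂m ≤ (∫⁻ s, ‖f s‖ₑ ∂m + ε) * (∫⁻ s, ‖g s‖ₑ ∂m + ε) := by
    rw [hΦ, lintegral_tsum fun i => (Measurable.tsum fun j =>
      measurable_lintegral_enorm_mul_inv_mul (hh i).1 (hh i).2 (hk j).1).aemeasurable]
    simp_rw [lintegral_tsum fun j =>
      (measurable_lintegral_enorm_mul_inv_mul (m := m) (hh _).1 (hh _).2 (hk j).1).aemeasurable,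
      lintegral_lintegral_enorm_mul_inv_mul (hh _).1 (hh _).2 (hk _).1 (hk _).2,
      ENNReal.tsum_mul_left, ENNReal.tsum_mul_right]
    gcongr
  have hΦtop : ∀ᵐ t ∂m, Φ t < ∞ := ae_lt_top hΦmeas <| ne_top_of_le_ne_top
    (ENNReal.mul_ne_top (ENNReal.add_ne_top.2 ⟨hf.2.ne, ENNReal.coe_ne_top⟩)
      (ENNReal.add_ne_top.2 ⟨hg.2.ne, ENNReal.coe_ne_top⟩)) hΦint
  have hdom : ∀ t, ∫⁻ s, (∑' i, ‖h i s‖ₑ) * ∑' j, ‖k j (s⁻¹ * t)‖ₑ ∂m = Φ t := fun t => by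
    have hmh : ∀ i, Measurable fun s => ‖h i s‖ₑ := fun i => (hh i).1.measurable.enorm
    have hmk : ∀ j, Measurable fun s => ‖k j (s⁻¹ * t)‖ₑ := fun j =>
      ((hk j).1.comp (by fun_prop : Continuous fun s : G => s⁻¹ * t)).measurable.enorm
    have hmhk : ∀ i j, AEMeasurable (fun s => ‖h i s‖ₑ * ‖k j (s⁻¹ * t)‖ₑ) m := fun i j =>
      ((hmh i).mul (hmk j)).aemeasurable
    simp_rw [← ENNReal.tsum_mul_right, ← ENNReal.tsum_mul_left]
    rw [lintegral_tsum fun i => AEMeasurable.tsum (hmhk i)]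
    exact tsum_congr fun i => lintegral_tsum (hmhk i)
  have hdmeas : ∀ t, AEMeasurable (fun s => (∑' i, ‖h i s‖ₑ) * ∑' j, ‖k j (s⁻¹ * t)‖ₑ) m := fun t =>
    ((Measurable.tsum fun i => (hh i).1.measurable.enorm).mul (Measurable.tsum fun j =>
      ((hk j).1.comp (by fun_prop : Continuous fun s : G => s⁻¹ * t)).measurable.enorm)).aemeasurable
  have hpt : ∀ t, ∀ᵐ s ∂m, Tendsto (fun n => F n s * K n (s⁻¹ * t)) atTop
      (𝓝 (f s * g (s⁻¹ * t))) := fun t => by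
    filter_upwards [hFf, ae_inv_mul_of_ae m hKg t] with s h1 h2 using h1.mul h2
  have hbd : ∀ t n s, ‖F n s * K n (s⁻¹ * t)‖ₑ ≤
      (∑' i, ‖h i s‖ₑ) * ∑' j, ‖k j (s⁻¹ * t)‖ₑ := fun t n s => by
    rw [enorm_mul]
    exact mul_le_mul' (hFh n s) (hKk n _)
  have hmeas : ∀ t n, AEStronglyMeasurable (fun s => F n s * K n (s⁻¹ * t)) m := fun t n =>
    ((hF n).1.mul ((hK n).1.comp (by fun_prop))).aestronglyMeasurable
  have hmeas' : ∀ t, AEStronglyMeasurable (fun s => f s * g (s⁻¹ * t)) m := fun t =>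
    aestronglyMeasurable_of_tendsto_ae _ (hmeas t) (hpt t)
  have hle : ∀ t, ∫⁻ s, ‖f s * g (s⁻¹ * t)‖ₑ ∂m ≤ Φ t := fun t => by
    rw [← hdom]
    refine lintegral_mono_ae ?_
    filter_upwards [hpt t] with s hs
    exact le_of_tendsto hs.enorm (Eventually.of_forall fun n => hbd t n s)
  have hint : ∀ᵐ t ∂m, Integrable (fun s => f s * g (s⁻¹ * t)) m := by
    filter_upwards [hΦtop] with t ht using ⟨hmeas' t, (hle t).trans_lt ht⟩
  refine ⟨?_, hint, ?_⟩
  -- Wherever `Φ` is finite, dominated convergence exhibits `f * g` as the limit of the continuous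
  -- functions `F n * K n`.
  · refine aestronglyMeasurable_of_tendsto_ae (u := atTop) (f := fun n => groupConv m (F n) (K n))
      (fun n => (continuous_integral_mul_inv_mul (hF n).1 (hF n).2 (hK n).1).aestronglyMeasurable) ?_
    filter_upwards [hΦtop] with t ht
    refine tendsto_integral_filter_of_dominated_convergence
      (fun s => ((∑' i, ‖h i s‖ₑ) * ∑' j, ‖k j (s⁻¹ * t)‖ₑ).toReal) ?_ ?_ ?_ (hpt t)
    · exact Eventually.of_forall (hmeas t)
    · filter_upwards with n
      filter_upwards [ae_lt_top' (hdmeas t) ((hdom t).trans_lt ht).ne] with s hs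
      rw [← toReal_enorm]
      exact ENNReal.toReal_mono hs.ne (hbd t n s)
    · exact integrable_toReal_of_lintegral_ne_top (hdmeas t) ((hdom t).trans_lt ht).ne
  · calc ∫⁻ t, ‖groupConv m f g t‖ₑ ∂m ≤ ∫⁻ t, Φ t ∂m :=
          lintegral_mono fun t => (enorm_integral_le_lintegral_enorm _).trans (hle t)
      _ ≤ _ := hΦint

/-- The convolution of two integrable functions, without countability assumptions on `G`. -/
theorem aestronglyMeasurable_groupConv [m.IsHaarMeasure] [m.Regular] {f g : G → ℂ}
    (hf : Integrable f m) (hg : Integrable g m) : AEStronglyMeasurable (groupConv m f g) m :=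
  (groupConv_estimates_of_pos hf hg one_pos).1

theorem ae_integrable_mul_inv_mul [m.IsHaarMeasure] [m.Regular] {f g : G → ℂ}
    (hf : Integrable f m) (hg : Integrable g m) :
    ∀ᵐ t ∂m, Integrable (fun s => f s * g (s⁻¹ * t)) m :=
  (groupConv_estimates_of_pos hf hg one_pos).2.1

theorem lintegral_enorm_groupConv_le [m.IsHaarMeasure] [m.Regular] {f g : G → ℂ}
    (hf : Integrable f m) (hg : Integrable g m) :
    ∫⁻ t, ‖groupConv m f g t‖ₑ ∂m ≤ (∫⁻ s, ‖f s‖ₑ ∂m) * ∫⁻ s, ‖g s‖ₑ ∂m := by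
  have hlim : ∀ a : ℝ≥0∞, Tendsto (fun ε : ℝ≥0 => a + ε) (𝓝[>] 0) (𝓝 a) := fun a => by
    have : Tendsto (fun ε : ℝ≥0 => a + ε) (𝓝 0) (𝓝 (a + (0 : ℝ≥0))) :=
      tendsto_const_nhds.add (ENNReal.tendsto_coe.2 tendsto_id)
    rw [ENNReal.coe_zero, add_zero] at this
    exact this.mono_left nhdsWithin_le_nhds
  -- Let `ε → 0`; finite norms avoid the discontinuity of multiplication at `(0, ∞)`.
  refine ge_of_tendsto (ENNReal.Tendsto.mul (hlim _) (Or.inr hg.2.ne) (hlim _) (Or.inr hf.2.ne)) ?_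
  filter_upwards [self_mem_nhdsWithin] with ε hε
  exact (groupConv_estimates_of_pos hf hg hε).2.2

end Convolution

/-! ### The Banach algebra structure of `L¹(G, ω)`. -/

namespace WeightedL1

section Weight

variable {G : Type*} [Group G] [TopologicalSpace G] [MeasurableSpace G]
  {m : Measure G} {ω : G → ℝ}

theorem ae_iff_ae (hω : IsWeight ω) {p : G → Prop} :
    (∀ᵐ t ∂weightedMeasure m ω, p t) ↔ ∀ᵐ t ∂m, p t := by
  rw [ae_weightedMeasure m hω]

theorem integrable_coe (hω : IsWeight ω) (f : WeightedL1 m ω) : Integrable f m :=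
  ((memLp_weightedMeasure_iff m hω f).1 (Lp.memLp f)).1

theorem integrable_norm_mul (hω : IsWeight ω) (f : WeightedL1 m ω) :
    Integrable (fun t => ((‖f t‖ * ω t : ℝ) : ℂ)) m :=
  ((memLp_weightedMeasure_iff m hω f).1 (Lp.memLp f)).2.ofReal

theorem lintegral_weightedMeasure (hω : IsWeight ω) {f : G → ℂ} (hf : AEStronglyMeasurable f m) :
    ∫⁻ t, ‖f t‖ₑ ∂weightedMeasure m ω = ∫⁻ t, ‖((‖f t‖ * ω t : ℝ) : ℂ)‖ₑ ∂m := by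
  rw [weightedMeasure, lintegral_withDensity_eq_lintegral_mul₀
    hω.measurable.ennreal_ofReal.aemeasurable hf.enorm]
  refine lintegral_congr fun t => ?_
  have h0 : 0 ≤ ω t := zero_le_one.trans (hω.one_le t)
  rw [Pi.mul_apply, ← ofReal_norm ((‖f t‖ * ω t : ℝ) : ℂ), Complex.norm_real, norm_mul, norm_norm,
    Real.norm_of_nonneg h0, ENNReal.ofReal_mul (norm_nonneg _), ofReal_norm, mul_comm]

theorem enorm_eq_lintegral (hω : IsWeight ω) (f : WeightedL1 m ω) :
    ‖f‖ₑ = ∫⁻ t, ‖((‖f t‖ * ω t : ℝ) : ℂ)‖ₑ ∂m := by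
  rw [← lintegral_weightedMeasure hω (integrable_coe hω f).1, Lp.enorm_def,
    eLpNorm_one_eq_lintegral_enorm]

theorem ext_of_ae (hω : IsWeight ω) {f g : WeightedL1 m ω} (h : ∀ᵐ t ∂m, f t = g t) : f = g :=
  Lp.ext ((ae_iff_ae hω).2 h)

theorem coeFn_add (hω : IsWeight ω) (f g : WeightedL1 m ω) : ∀ᵐ t ∂m, (f + g) t = f t + g t :=
  (ae_iff_ae hω).1 (Lp.coeFn_add f g)

theorem coeFn_smul (hω : IsWeight ω) (c : ℂ) (f : WeightedL1 m ω) :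
    ∀ᵐ t ∂m, (c • f) t = c * f t :=
  (ae_iff_ae hω).1 (Lp.coeFn_smul c f)

end Weight

variable {G : Type*} [Group G] [TopologicalSpace G] [IsTopologicalGroup G]
    [LocallyCompactSpace G] [MeasurableSpace G] [BorelSpace G] {m : Measure G}
    [m.IsHaarMeasure] [m.Regular] {ω : G → ℝ}

/-- Since `ω t ≤ ω s * ω (s⁻¹ * t)`, the function `|f * g| ω` is bounded almost everywhere by the
convolution of `|f| ω` and `|g| ω`, which reduces the claim to the unweighted case. -/
theorem lintegral_enorm_groupConv_le (hω : IsWeight ω) (f g : WeightedL1 m ω) :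
    ∫⁻ t, ‖groupConv m f g t‖ₑ ∂weightedMeasure m ω ≤ ‖f‖ₑ * ‖g‖ₑ := by
  rw [lintegral_weightedMeasure hω (aestronglyMeasurable_groupConv (integrable_coe hω f)
    (integrable_coe hω g)), enorm_eq_lintegral hω f, enorm_eq_lintegral hω g]
  have hf := integrable_norm_mul hω f
  have hg := integrable_norm_mul hω g
  refine le_trans (lintegral_mono_ae ?_) (_root_.lintegral_enorm_groupConv_le hf hg)
  have hω0 : ∀ t, 0 ≤ ω t := fun t => zero_le_one.trans (hω.one_le t)
  filter_upwards [ae_integrable_mul_inv_mul hf hg] with t ht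
  have hre : ∀ s, ((‖f s‖ * ω s : ℝ) : ℂ) * ((‖g (s⁻¹ * t)‖ * ω (s⁻¹ * t) : ℝ) : ℂ) =
      (((‖f s‖ * ω s) * (‖g (s⁻¹ * t)‖ * ω (s⁻¹ * t)) : ℝ) : ℂ) := fun s => by push_cast; ring
  have hint : Integrable (fun s => (‖f s‖ * ω s) * (‖g (s⁻¹ * t)‖ * ω (s⁻¹ * t))) m := by
    have := ht.re
    simp_rw [hre] at this
    exact this
  refine enorm_le_iff_norm_le.2 ?_
  unfold groupConv
  simp_rw [hre]
  rw [integral_complex_ofReal, Complex.norm_real, Complex.norm_real, norm_mul, norm_norm,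
    Real.norm_of_nonneg (hω0 t), mul_comm]
  calc ω t * ‖∫ s, f s * g (s⁻¹ * t) ∂m‖ ≤ ω t * ∫ s, ‖f s * g (s⁻¹ * t)‖ ∂m := by
        gcongr
        · exact hω0 t
        · exact norm_integral_le_integral_norm _
    _ = ∫ s, ω t * ‖f s * g (s⁻¹ * t)‖ ∂m := (integral_const_mul _ _).symm
    _ ≤ ∫ s, (‖f s‖ * ω s) * (‖g (s⁻¹ * t)‖ * ω (s⁻¹ * t)) ∂m := by
        refine integral_mono_of_nonneg (Eventually.of_forall fun s => ?_) hint
          (Eventually.of_forall fun s => ?_)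
        · exact mul_nonneg (hω0 t) (norm_nonneg _)
        · have h1 := hω.map_mul_le s (s⁻¹ * t)
          rw [mul_inv_cancel_left] at h1
          calc ω t * ‖f s * g (s⁻¹ * t)‖
              ≤ (ω s * ω (s⁻¹ * t)) * ‖f s * g (s⁻¹ * t)‖ := by gcongr
            _ = _ := by rw [norm_mul]; ring
    _ ≤ _ := Real.le_norm_self _

theorem memLp_groupConv (hω : IsWeight ω) (f g : WeightedL1 m ω) :
    MemLp (groupConv m f g) 1 (weightedMeasure m ω) := by
  refine ⟨(aestronglyMeasurable_groupConv (integrable_coe hω f)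
    (integrable_coe hω g)).mono_ac (withDensity_absolutelyContinuous m _), ?_⟩
  rw [eLpNorm_one_eq_lintegral_enorm]
  exact (lintegral_enorm_groupConv_le hω f g).trans_lt (by finiteness)

theorem conv_eq_toLp (hω : IsWeight ω) (f g : WeightedL1 m ω) :
    conv f g = (memLp_groupConv hω f g).toLp _ :=
  dif_pos (memLp_groupConv hω f g)

theorem coeFn_conv (hω : IsWeight ω) (f g : WeightedL1 m ω) :
    ∀ᵐ t ∂m, conv f g t = groupConv m f g t := by
  rw [conv_eq_toLp hω]
  exact (ae_iff_ae hω).1 (memLp_groupConv hω f g).coeFn_toLp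

theorem norm_conv_le (hω : IsWeight ω) (f g : WeightedL1 m ω) : ‖conv f g‖ ≤ ‖f‖ * ‖g‖ := by
  have : ‖conv f g‖ₑ ≤ ‖f‖ₑ * ‖g‖ₑ := by
    rw [conv_eq_toLp hω, Lp.enorm_toLp, eLpNorm_one_eq_lintegral_enorm]
    exact lintegral_enorm_groupConv_le hω f g
  have h := ENNReal.toReal_mono (by finiteness) this
  rwa [ENNReal.toReal_mul, toReal_enorm, toReal_enorm, toReal_enorm] at h

theorem add_conv (hω : IsWeight ω) (f g h : WeightedL1 m ω) :
    conv (f + g) h = conv f h + conv g h := by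
  refine ext_of_ae hω ?_
  filter_upwards [coeFn_conv hω (f + g) h, coeFn_conv hω f h, coeFn_conv hω g h,
    coeFn_add hω (conv f h) (conv g h),
    ae_integrable_mul_inv_mul (integrable_coe hω f) (integrable_coe hω h),
    ae_integrable_mul_inv_mul (integrable_coe hω g) (integrable_coe hω h)] with t h1 h2 h3 h4 h5 h6
  rw [h1, h4, h2, h3, groupConv, groupConv, groupConv, ← integral_add h5 h6]
  refine integral_congr_ae ?_
  filter_upwards [coeFn_add hω f g] with s hs
  rw [hs, add_mul]

theorem conv_add (hω : IsWeight ω) (h f g : WeightedL1 m ω) :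
    conv h (f + g) = conv h f + conv h g := by
  refine ext_of_ae hω ?_
  filter_upwards [coeFn_conv hω h (f + g), coeFn_conv hω h f, coeFn_conv hω h g,
    coeFn_add hω (conv h f) (conv h g),
    ae_integrable_mul_inv_mul (integrable_coe hω h) (integrable_coe hω f),
    ae_integrable_mul_inv_mul (integrable_coe hω h) (integrable_coe hω g)] with t h1 h2 h3 h4 h5 h6
  rw [h1, h4, h2, h3, groupConv, groupConv, groupConv, ← integral_add h5 h6]
  refine integral_congr_ae ?_
  filter_upwards [ae_inv_mul_of_ae m (coeFn_add hω f g) t] with s hs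
  rw [hs, mul_add]

theorem smul_conv (hω : IsWeight ω) (c : ℂ) (f h : WeightedL1 m ω) :
    conv (c • f) h = c • conv f h := by
  refine ext_of_ae hω ?_
  filter_upwards [coeFn_conv hω (c • f) h, coeFn_conv hω f h, coeFn_smul hω c (conv f h)]
    with t h1 h2 h3
  rw [h1, h3, h2, groupConv, groupConv, ← integral_const_mul]
  refine integral_congr_ae ?_
  filter_upwards [coeFn_smul hω c f] with s hs
  rw [hs, mul_assoc]

theorem conv_smul (hω : IsWeight ω) (c : ℂ) (h f : WeightedL1 m ω) :
    conv h (c • f) = c • conv h f := by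
  refine ext_of_ae hω ?_
  filter_upwards [coeFn_conv hω h (c • f), coeFn_conv hω h f, coeFn_smul hω c (conv h f)]
    with t h1 h2 h3
  rw [h1, h3, h2, groupConv, groupConv, ← integral_const_mul]
  refine integral_congr_ae ?_
  filter_upwards [ae_inv_mul_of_ae m (coeFn_smul hω c f) t] with s hs
  rw [hs, mul_left_comm]

/-- The multiplication of `L¹(G, ω)` as a bounded bilinear map. -/
noncomputable def convL (hω : IsWeight ω) :
    WeightedL1 m ω →L[ℂ] WeightedL1 m ω →L[ℂ] WeightedL1 m ω :=
  LinearMap.mkContinuous₂ (LinearMap.mk₂ ℂ conv (add_conv hω) (smul_conv hω) (conv_add hω)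
    (conv_smul hω)) 1 fun f g => by simpa using norm_conv_le hω f g

end WeightedL1

/-! ### The Banach space `L¹ ∩ L^∞`. -/

section BoundedFunctions

variable {X : Type*} [MeasurableSpace X] (μ : Measure X)

/-- `L¹ ∩ L^∞`, as the space of all pairs in `L¹ × L^∞` that consist of two copies of the same
function. -/
noncomputable def lpOneTop : Submodule ℂ (Lp ℂ 1 μ × Lp ℂ ∞ μ) where
  carrier := {p | (p.1 : X → ℂ) =ᵐ[μ] p.2}
  add_mem' := fun {p q} (hp : (p.1 : X → ℂ) =ᵐ[μ] p.2) (hq : (q.1 : X → ℂ) =ᵐ[μ] q.2) => by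
    change ((p.1 + q.1 : Lp ℂ 1 μ) : X → ℂ) =ᵐ[μ] (p.2 + q.2 : Lp ℂ ∞ μ)
    exact (Lp.coeFn_add _ _).trans ((EventuallyEq.add hp hq).trans (Lp.coeFn_add _ _).symm)
  zero_mem' := by
    change ((0 : Lp ℂ 1 μ) : X → ℂ) =ᵐ[μ] (0 : Lp ℂ ∞ μ)
    exact (Lp.coeFn_zero _ _ _).trans (Lp.coeFn_zero _ _ _).symm
  smul_mem' := fun c p (hp : (p.1 : X → ℂ) =ᵐ[μ] p.2) => by
    change ((c • p.1 : Lp ℂ 1 μ) : X → ℂ) =ᵐ[μ] (c • p.2 : Lp ℂ ∞ μ)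
    exact (Lp.coeFn_smul _ _).trans ((EventuallyEq.const_smul hp c).trans (Lp.coeFn_smul _ _).symm)

/-- Convergence in either norm implies convergence in measure, whose limits are unique almost
everywhere. -/
theorem isClosed_lpOneTop : IsClosed (lpOneTop μ : Set (Lp ℂ 1 μ × Lp ℂ ∞ μ)) := by
  refine IsSeqClosed.isClosed fun u p hu hp => ?_
  have h1 := tendstoInMeasure_of_tendsto_Lp ((continuous_fst.tendsto p).comp hp)
  have h2 := tendstoInMeasure_of_tendsto_Lp ((continuous_snd.tendsto p).comp hp)
  have hu' : ∀ n, ((u n).1 : X → ℂ) =ᵐ[μ] (u n).2 := hu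
  exact tendstoInMeasure_ae_unique h1 (h2.congr (fun n => (hu' n).symm) EventuallyEq.rfl)

instance : CompleteSpace (lpOneTop μ) := (isClosed_lpOneTop μ).completeSpace_coe

/-- The embedding of `L¹ ∩ L^∞` into `L¹`. -/
noncomputable def lpOneTopInclusion : lpOneTop μ →L[ℂ] Lp ℂ 1 μ :=
  (ContinuousLinearMap.fst ℂ _ _).comp (lpOneTop μ).subtypeL

variable {μ}

theorem mem_range_lpOneTopInclusion {f : Lp ℂ 1 μ} :
    f ∈ (lpOneTopInclusion μ).range ↔ MemLp f ∞ μ := by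
  constructor
  · rintro ⟨⟨p, hp⟩, rfl⟩
    exact (memLp_congr_ae hp).2 (Lp.memLp p.2)
  · intro h
    exact ⟨⟨(f, h.toLp f), h.coeFn_toLp.symm⟩, rfl⟩

theorem denseRange_lpOneTopInclusion : DenseRange (lpOneTopInclusion μ) := by
  refine (Lp.simpleFunc.denseRange (E := ℂ) (μ := μ) ENNReal.one_ne_top).mono ?_
  rintro _ ⟨f, rfl⟩
  refine mem_range_lpOneTopInclusion.2 ?_
  exact (memLp_congr_ae (Lp.simpleFunc.toSimpleFunc_eq_toFun f)).1
    (SimpleFunc.memLp_top _ _)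

/-- If there are sets of arbitrarily small positive measure, then `L¹` is not contained
in `L^∞`. -/
theorem range_lpOneTopInclusion_ne_top
    (h : ∀ ε > 0, ∃ s, MeasurableSet s ∧ μ s ≠ 0 ∧ μ s < ε) :
    (lpOneTopInclusion μ).range ≠ ⊤ := by
  intro htop
  -- If the inclusion were onto, the open mapping theorem would bound the `L^∞` norm by `C` times
  -- the `L¹` norm; the indicator of a set of measure below `C⁻¹` violates this.
  obtain ⟨C, hC, hinv⟩ := (lpOneTopInclusion μ).exists_preimage_norm_le
    (LinearMap.range_eq_top.1 htop)
  obtain ⟨s, hs, hs0, hsε⟩ := h (ENNReal.ofReal C⁻¹) (by simpa using hC)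
  have hs' : μ s ≠ ∞ := (hsε.trans_le le_top).ne
  obtain ⟨⟨⟨f, g⟩, hfg⟩, hf, hn⟩ := hinv (indicatorConstLp 1 hs hs' 1)
  have hf : f = indicatorConstLp 1 hs hs' 1 := hf
  subst hf
  have hfg' : (indicatorConstLp 1 hs hs' (1 : ℂ) : X → ℂ) =ᵐ[μ] g := hfg
  have hg : g = indicatorConstLp ∞ hs hs' 1 :=
    Lp.ext (hfg'.symm.trans (indicatorConstLp_coeFn.trans indicatorConstLp_coeFn.symm))
  have h1 : ‖g‖ = 1 := by
    rw [hg, norm_indicatorConstLp_top hs0, norm_one]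
  have h2 : ‖g‖ ≤ C * μ.real s := by
    refine (norm_snd_le ((indicatorConstLp 1 hs hs' (1 : ℂ), g) : Lp ℂ 1 μ × Lp ℂ ∞ μ)).trans
      (hn.trans_eq ?_)
    rw [norm_indicatorConstLp one_ne_zero ENNReal.one_ne_top]
    simp
  have h3 : μ.real s < C⁻¹ := by
    rw [measureReal_def]
    exact (ENNReal.lt_ofReal_iff_toReal_lt hs').1 hsε
  have h4 : C * μ.real s < 1 := by
    calc C * μ.real s < C * C⁻¹ := by gcongr
      _ = 1 := mul_inv_cancel₀ hC.ne'
  linarith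

end BoundedFunctions

/-! ### The dense left ideal of bounded functions, and the conclusion. -/

namespace WeightedL1

variable {G : Type*} [Group G] [TopologicalSpace G] [IsTopologicalGroup G]
    [LocallyCompactSpace G] [MeasurableSpace G] [BorelSpace G] {m : Measure G}
    [m.IsHaarMeasure] [m.Regular] {ω : G → ℝ}

/-- The bound is `‖f * g‖_∞ ≤ ‖f‖₁ ‖g‖_∞`, with the unweighted `L¹` norm. It makes the bounded
functions a left ideal. -/
theorem memLp_top_conv (hω : IsWeight ω) (f g : WeightedL1 m ω)
    (hg : MemLp g ∞ (weightedMeasure m ω)) : MemLp (conv f g) ∞ (weightedMeasure m ω) := by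
  set C := (eLpNormEssSup g (weightedMeasure m ω)).toReal with hC
  have hgtop : eLpNormEssSup g (weightedMeasure m ω) ≠ ∞ := by
    rw [← eLpNorm_exponent_top]
    exact hg.2.ne
  have hgC : ∀ᵐ t ∂m, ‖g t‖ ≤ C := by
    filter_upwards [(ae_iff_ae hω).1 (ae_le_eLpNormEssSup (f := g))] with t ht
    rw [← toReal_enorm]
    exact ENNReal.toReal_mono hgtop ht
  refine memLp_top_of_bound (Lp.aestronglyMeasurable _) (∫ s, ‖f s‖ * C ∂m)
    ((ae_iff_ae hω).2 ?_)
  filter_upwards [coeFn_conv hω f g] with t ht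
  rw [ht]
  refine norm_integral_le_of_norm_le ((integrable_coe hω f).norm.mul_const C) ?_
  filter_upwards [ae_inv_mul_of_ae m hgC t] with s hs
  rw [norm_mul]
  gcongr

/-- Points are null when `G` is not discrete, so outer regularity yields small open neighbourhoods
of `1`; inside a compact neighbourhood, where `ω ≤ C`, they are also small for `ω dm`. -/
theorem exists_weightedMeasure_lt [T2Space G] (hG : ¬ DiscreteTopology G) (hω : IsWeight ω)
    {ε : ℝ≥0∞} (hε : 0 < ε) : ∃ s, MeasurableSet s ∧ weightedMeasure m ω s ≠ 0 ∧
      weightedMeasure m ω s < ε := by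
  have hne : (𝓝[≠] (1 : G)).NeBot := by
    by_contra h
    rw [not_neBot, ← isOpen_singleton_iff_punctured_nhds] at h
    exact hG (discreteTopology_of_isOpen_singleton_one h)
  have := Measure.IsHaarMeasure.nullSingletonClass m
  obtain ⟨K, hK, hK1⟩ := exists_compact_mem_nhds (1 : G)
  obtain ⟨C, hC⟩ := hω.bddAbove_image K hK
  have hC1 : 0 < C := one_pos.trans_le ((hω.one_le 1).trans
    (hC ⟨1, mem_of_mem_nhds hK1, rfl⟩))
  have hC0 : ENNReal.ofReal C ≠ 0 := by simpa using hC1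
  obtain ⟨U, h1U, hU, hUε⟩ := Set.exists_isOpen_lt_of_lt {(1 : G)} (ε / ENNReal.ofReal C) (by
    rw [measure_singleton]
    exact ENNReal.div_pos hε.ne' ENNReal.ofReal_ne_top) (μ := m)
  have hs : IsOpen (U ∩ interior K) := hU.inter isOpen_interior
  refine ⟨U ∩ interior K, hs.measurableSet, ?_, ?_⟩
  · intro h0
    have : m (U ∩ interior K) = 0 :=
      withDensity_absolutelyContinuous' hω.measurable.ennreal_ofReal.aemeasurable
        (Eventually.of_forall fun t => by simpa using one_pos.trans_le (hω.one_le t)) h0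
    exact (hs.measure_pos m ⟨1, h1U rfl, mem_interior_iff_mem_nhds.2 hK1⟩).ne' this
  · rw [weightedMeasure, withDensity_apply _ hs.measurableSet]
    calc ∫⁻ t in U ∩ interior K, ENNReal.ofReal (ω t) ∂m
        ≤ ∫⁻ _ in U ∩ interior K, ENNReal.ofReal C ∂m :=
          setLIntegral_mono measurable_const fun t ht =>
            ENNReal.ofReal_le_ofReal (hC ⟨t, interior_subset ht.2, rfl⟩)
      _ = ENNReal.ofReal C * m (U ∩ interior K) := setLIntegral_const _ _
      _ ≤ ENNReal.ofReal C * m U := by gcongr; exact Set.inter_subset_left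
      _ < ENNReal.ofReal C * (ε / ENNReal.ofReal C) :=
          ENNReal.mul_lt_mul_right hC0 ENNReal.ofReal_ne_top hUε
      _ ≤ ε := ENNReal.mul_div_le

/-- A closed, finitely generated left ideal does not complement `L¹ ∩ L^∞` in `L¹(G, ω)`. -/
theorem sup_range_lpOneTopInclusion_ne_top [T2Space G] (hG : ¬ DiscreteTopology G)
    (hω : IsWeight ω) {I : Submodule ℂ (WeightedL1 m ω)} (hI : IsLeftIdeal I)
    (hIc : IsClosed (I : Set (WeightedL1 m ω))) (hfg : IsFinitelyGenerated I) :
    I ⊔ (lpOneTopInclusion (weightedMeasure m ω)).range ≠ ⊤ := by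
  intro htop
  obtain ⟨n, x, hx⟩ := hfg
  have hle := le_range_of_finitelyGenerated (convL hω) I hIc hI x hx
    (lpOneTopInclusion (weightedMeasure m ω)) denseRange_lpOneTopInclusion
    (fun a y hy => mem_range_lpOneTopInclusion.2
      (memLp_top_conv hω a y (mem_range_lpOneTopInclusion.1 hy))) htop
  rw [sup_eq_right.2 hle] at htop
  exact range_lpOneTopInclusion_ne_top (fun ε hε => exists_weightedMeasure_lt hG hω hε) htop

end WeightedL1

theorem theorem3p3 {G : Type*} [Group G] [TopologicalSpace G] [IsTopologicalGroup G]
    [T2Space G] [LocallyCompactSpace G] [MeasurableSpace G] [BorelSpace G]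
    (hG : ¬ DiscreteTopology G)
    (m : Measure G) [m.IsHaarMeasure] [m.Regular]
    (ω : G → ℝ) (hω : IsWeight ω) :
    (∀ I : Submodule ℂ (WeightedL1 m ω), WeightedL1.IsMaximalLeftIdeal I →
      IsClosed (I : Set (WeightedL1 m ω)) → ¬ WeightedL1.IsFinitelyGenerated I) ∧
    (∀ I : Submodule ℂ (WeightedL1 m ω), WeightedL1.IsLeftIdeal I →
      IsClosed (I : Set (WeightedL1 m ω)) →
      FiniteDimensional ℂ (WeightedL1 m ω ⧸ I) → ¬ WeightedL1.IsFinitelyGenerated I) := by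
  set J := (lpOneTopInclusion (weightedMeasure m ω)).range with hJ
  have hJdense : J.topologicalClosure = ⊤ := by
    rw [← Submodule.dense_iff_topologicalClosure_eq_top]
    exact denseRange_lpOneTopInclusion
  refine ⟨fun I hI hIc hfg => ?_, fun I hI hIc hfin hfg => ?_⟩
  · refine WeightedL1.sup_range_lpOneTopInclusion_ne_top hG hω hI.prop.1 hIc hfg ?_
    -- If the left ideal `I ⊔ J` were proper, maximality would give `J ≤ I`, and then `I`, being
    -- closed, would contain the closure of `J`, which is everything.
    by_contra hne
    have hideal : WeightedL1.IsLeftIdeal (I ⊔ J) := by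
      intro a x hx
      obtain ⟨y, hy, z, hz, rfl⟩ := Submodule.mem_sup.1 hx
      rw [WeightedL1.conv_add hω]
      exact Submodule.add_mem_sup (hI.prop.1 a y hy) (mem_range_lpOneTopInclusion.2
        (WeightedL1.memLp_top_conv hω a z (mem_range_lpOneTopInclusion.1 hz)))
    have hle : I ⊔ J ≤ I := hI.le_of_ge ⟨hideal, hne⟩ le_sup_left
    refine hI.prop.2 (top_le_iff.1 ?_)
    rw [← hJdense]
    exact Submodule.topologicalClosure_minimal _ (le_sup_right.trans hle) hIc
  · refine WeightedL1.sup_range_lpOneTopInclusion_ne_top hG hω hI hIc hfg ?_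
    -- A subspace containing a closed subspace of finite codimension is closed; this one is also
    -- dense.
    have hclosed : IsClosed ((I ⊔ J : Submodule ℂ (WeightedL1 m ω)) : Set (WeightedL1 m ω)) :=
      Submodule.isClosed_mono_of_finiteDimensional_quotient hIc le_sup_left
    refine top_le_iff.1 ?_
    rw [← hJdense]
    exact Submodule.topologicalClosure_minimal _ le_sup_right hclosed
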